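/- Let $R$ be a commutative Noetherian ring and let $Z\subseteq\operatorname{Spec}R$ be specialization-closed, i.e. if $\mathfrak p\in Z$ and $\mathfrak p\subseteq\mathfrak q\in\operatorname{Spec}R$, then $\mathfrak q\in Z$. For an $R$-module $N$ put $\Gamma_Z(N)=\{x\in N\mid \operatorname{Supp}_R(Rx)\subseteq Z\}$, and let $H^i_Z(-)$ be the $i$-th right derived functor of $\Gamma_Z(-)$. Call $N$ $Z$-torsion if $\Gamma_Z(N)=N$, and $Z$-torsion-free if $\Gamma_Z(N)=0$. Put $\operatorname{grade}(Z,N)=\inf\{i\ge 0\mid H^i_Z(N)\neq 0\}$ (which is $\infty$ if there is no such $i$). Assume that $\operatorname{grade}(Z,R)\ge 1$. Let $M$ be a finitely generated $R$-module whose non-free locus $\operatorname{NF}(M)=\{\mathfrak p\in\operatorname{Spec}R\mid M_{\mathfrak p}\text{ is not free over }R_{\mathfrak p}\}$ is contained in $Z$, and let $M^*=\operatorname{Hom}_R(M,R)$. If $H^1_Z(M\otimes_R M^*)=0$, then $M=F\oplus T$ for submodules $F,T\subseteq M$, where $F$ is projective and $T$ is $Z$-torsion; if moreover $R$ is local, then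 $F$ is free. In particular, if $M$ is $Z$-torsion-free, then $M$ is projective, and $M$ is free if moreover $R$ is local. -/

import Mathlib

open CategoryTheory
open scoped TensorProduct

universe u v w

namespace SpecLC

theorem notMem_support_span_singleton {R : Type u} [CommRing R] {M : Type v} [AddCommGroup M]
    [Module R M] (p : PrimeSpectrum R) (m : M) :
    p ∉ Module.support R (Submodule.span R {m}) ↔ ∃ r ∉ p.asIdeal, r • m = 0 := by
  rw [Module.notMem_support_iff']
  constructor
  · intro h
    obtain ⟨r, hr, h0⟩ := h ⟨m, Submodule.mem_span_singleton_self m⟩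
    exact ⟨r, hr, congrArg Subtype.val h0⟩
  · rintro ⟨r, hr, h0⟩ ⟨x, hx⟩
    obtain ⟨a, rfl⟩ := Submodule.mem_span_singleton.mp hx
    refine ⟨r, hr, Subtype.ext ?_⟩
    simp [smul_comm r a m, h0]

theorem support_span_singleton_subset_iff {R : Type u} [CommRing R] {M : Type v} [AddCommGroup M]
    [Module R M] (Z : Set (PrimeSpectrum R)) (m : M) :
    Module.support R (Submodule.span R {m}) ⊆ Z ↔ ∀ p ∉ Z, ∃ r ∉ p.asIdeal, r • m = 0 := by
  simp_rw [← notMem_support_span_singleton]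
  exact Set.compl_subset_compl.symm

/-- The submodule `Γ_Z(M) = {m ∈ M ∣ Supp_R (R m) ⊆ Z}` of `M`. -/
def torsion {R : Type u} [CommRing R] (Z : Set (PrimeSpectrum R))
    (M : Type v) [AddCommGroup M] [Module R M] : Submodule R M where
  carrier := {m | Module.support R (Submodule.span R {m}) ⊆ Z}
  add_mem' := by
    intro a b ha hb
    rw [Set.mem_ofPred_eq, support_span_singleton_subset_iff] at *
    intro p hp
    obtain ⟨r, hr, h0⟩ := ha p hp
    obtain ⟨s, hs, h1⟩ := hb p hp
    refine ⟨r * s, p.isPrime.mul_notMem hr hs, ?_⟩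
    rw [smul_add, mul_smul r s b, h1, mul_comm, mul_smul s r a, h0]
    simp
  zero_mem' := by
    rw [Set.mem_ofPred_eq, support_span_singleton_subset_iff]
    intro p _
    exact ⟨1, p.asIdeal.ne_top_iff_one.mp p.isPrime.ne_top, smul_zero _⟩
  smul_mem' := by
    intro c a ha
    rw [Set.mem_ofPred_eq, support_span_singleton_subset_iff] at *
    intro p hp
    obtain ⟨r, hr, h0⟩ := ha p hp
    exact ⟨r, hr, by rw [smul_comm, h0, smul_zero]⟩

theorem mem_torsion_iff {R : Type u} [CommRing R] {Z : Set (PrimeSpectrum R)}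
    {M : Type v} [AddCommGroup M] [Module R M] {m : M} :
    m ∈ torsion Z M ↔ ∀ p ∉ Z, ∃ r ∉ p.asIdeal, r • m = 0 :=
  support_span_singleton_subset_iff Z m

theorem map_mem_torsion {R : Type u} [CommRing R] (Z : Set (PrimeSpectrum R))
    {M : Type v} [AddCommGroup M] [Module R M] {N : Type w} [AddCommGroup N] [Module R N]
    (f : M →ₗ[R] N) (m : M) (hm : m ∈ torsion Z M) : f m ∈ torsion Z N := by
  rw [mem_torsion_iff] at *
  intro p hp
  obtain ⟨r, hr, h0⟩ := hm p hp
  exact ⟨r, hr, by rw [← map_smul, h0, map_zero]⟩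

/-- `M` is torsion with respect to `Z`: `Γ_Z(M) = M`. -/
def IsTorsion {R : Type u} [CommRing R] (Z : Set (PrimeSpectrum R))
    (M : Type v) [AddCommGroup M] [Module R M] : Prop :=
  torsion Z M = ⊤

/-- `M` is torsion-free with respect to `Z`: `Γ_Z(M) = 0`. -/
def IsTorsionFree {R : Type u} [CommRing R] (Z : Set (PrimeSpectrum R))
    (M : Type v) [AddCommGroup M] [Module R M] : Prop :=
  torsion Z M = ⊥

/-- The functor `Γ_Z(-)` on `R`-modules; it acts on morphisms by restriction. -/
def torsionFunctor {R : Type u} [CommRing R] (Z : Set (PrimeSpectrum R)) :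
    ModuleCat.{u} R ⥤ ModuleCat.{u} R where
  obj M := ModuleCat.of R (torsion Z M)
  map f := ModuleCat.ofHom (f.hom.restrict (map_mem_torsion Z f.hom))

instance torsionFunctor_additive {R : Type u} [CommRing R] (Z : Set (PrimeSpectrum R)) :
    (torsionFunctor Z).Additive where
  map_add := rfl

/-- The `i`-th local cohomology module `H^i_Z(M)`, where `H^i_Z(-)` is the `i`-th right derived
functor of `Γ_Z(-)`. -/
noncomputable def localCohomology {R : Type u} [CommRing R] (Z : Set (PrimeSpectrum R)) (i : ℕ)
    (M : Type u) [AddCommGroup M] [Module R M] : ModuleCat.{u} R :=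
  ((torsionFunctor Z).rightDerived i).obj (ModuleCat.of R M)

/-- `grade(Z, M) = inf {i ≥ 0 ∣ H^i_Z(M) ≠ 0}`, which is `∞` if all `H^i_Z(M)` vanish. -/
noncomputable def grade {R : Type u} [CommRing R] (Z : Set (PrimeSpectrum R))
    (M : Type u) [AddCommGroup M] [Module R M] : ℕ∞ :=
  ⨅ (i : ℕ) (_ : Nontrivial (localCohomology Z i M)), (i : ℕ∞)

/-- The non-free locus `NF(M) = {p ∈ Spec R ∣ M_p is not free over R_p}`. -/
def nonFreeLocus (R : Type u) [CommRing R] (M : Type v) [AddCommGroup M] [Module R M] :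
    Set (PrimeSpectrum R) :=
  (Module.freeLocus R M)ᶜ

end SpecLC

namespace SpecLC

/-! ### Elementary properties of `Γ_Z`. -/

section Torsion

variable {R : Type u} [CommRing R] {Z : Set (PrimeSpectrum R)}

/-! Since `M` is free off `Z`, the natural map `φ : M ⊗ M* → End M` has `Z`-torsion kernel and
cokernel. Vanishing of `H¹_Z(M ⊗ M*)` then yields `x` such that `id - φ x` is torsion
(`exists_sub_mem_torsion`, resting on `injective_torsion`). Put `e = φ x`. As `Γ_Z(R) = 0`,
functionals on `M` kill torsion, hence so does `e`; since `m - e m` is torsion, `e` is idempotent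
with kernel `Γ_Z(M)`. It factors through a free module, so its range is projective
(`exists_isCompl_torsion`). -/

theorem mem_torsion_of_forall_smul_mem {M : Type v} [AddCommGroup M] [Module R M] {m : M}
    (h : ∀ p ∉ Z, ∃ r ∉ p.asIdeal, r • m ∈ torsion Z M) : m ∈ torsion Z M := by
  rw [mem_torsion_iff]
  intro p hp
  obtain ⟨r, hr, hm⟩ := h p hp
  obtain ⟨s, hs, h0⟩ := mem_torsion_iff.mp hm p hp
  exact ⟨s * r, p.isPrime.mul_notMem hs hr, by rw [mul_smul, h0]⟩

theorem mem_torsion_of_map_mem {M : Type v} [AddCommGroup M] [Module R M] {N : Type w}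
    [AddCommGroup N] [Module R N] {f : M →ₗ[R] N} (hf : Function.Injective f) {m : M}
    (hm : f m ∈ torsion Z N) : m ∈ torsion Z M := by
  rw [mem_torsion_iff] at *
  intro p hp
  obtain ⟨r, hr, h0⟩ := hm p hp
  exact ⟨r, hr, hf (by rw [map_smul, h0, map_zero])⟩

theorem isTorsion_torsion (M : Type v) [AddCommGroup M] [Module R M] :
    IsTorsion Z (torsion Z M) :=
  eq_top_iff.mpr fun m _ ↦
    mem_torsion_of_map_mem (torsion Z M).injective_subtype m.2

/-- A linear functional vanishes on the torsion when the base ring is torsion-free. -/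
theorem dual_apply_eq_zero (hR : torsion Z R = ⊥) {M : Type v} [AddCommGroup M] [Module R M]
    (f : Module.Dual R M) {m : M} (hm : m ∈ torsion Z M) : f m = 0 := by
  have := map_mem_torsion Z f m hm
  rwa [hR, Submodule.mem_bot] at this

/-- A finitely generated submodule of the torsion is annihilated, for each prime outside `Z`, by an
element outside that prime. -/
theorem exists_smul_eq_zero_of_fg {M : Type v} [AddCommGroup M] [Module R M] {N : Submodule R M}
    (hN : N.FG) (h : N ≤ torsion Z M) {p : PrimeSpectrum R} (hp : p ∉ Z) :
    ∃ r ∉ p.asIdeal, ∀ m ∈ N, r • m = 0 := by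
  induction N, hN using Submodule.fg_induction with
  | singleton x =>
    obtain ⟨r, hr, h0⟩ := mem_torsion_iff.mp (h (Submodule.mem_span_singleton_self x)) p hp
    refine ⟨r, hr, fun m hm ↦ ?_⟩
    obtain ⟨a, rfl⟩ := Submodule.mem_span_singleton.mp hm
    rw [smul_comm, h0, smul_zero]
  | sup N₁ N₂ _ _ h₁ h₂ =>
    obtain ⟨r, hr, hr0⟩ := h₁ (le_sup_left.trans h)
    obtain ⟨s, hs, hs0⟩ := h₂ (le_sup_right.trans h)
    refine ⟨r * s, p.isPrime.mul_notMem hr hs, fun m hm ↦ ?_⟩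
    obtain ⟨a, ha, b, hb, rfl⟩ := Submodule.mem_sup.mp hm
    rw [smul_add, mul_smul r s b, hs0 b hb, mul_comm, mul_smul s r a, hr0 a ha]
    simp

end Torsion

/-! ### Injective modules and `Γ_Z`. -/

/-- A map into an injective module factors through any map with smaller kernel. -/
theorem exists_comp_eq_of_ker_le {R : Type u} [CommRing R] {A B J : Type u} [AddCommGroup A]
    [Module R A] [AddCommGroup B] [Module R B] [AddCommGroup J] [Module R J] [Module.Injective R J]
    (g : A →ₗ[R] B) (f : A →ₗ[R] J) (h : LinearMap.ker g ≤ LinearMap.ker f) :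
    ∃ k : B →ₗ[R] J, ∀ a, k (g a) = f a := by
  obtain ⟨k, hk⟩ := Module.Injective.out (Q := J) (R := R)
    ((LinearMap.ker g).liftQ g le_rfl)
    (LinearMap.ker_eq_bot.mp (Submodule.ker_liftQ_eq_bot' _ _ rfl))
    ((LinearMap.ker g).liftQ f h)
  exact ⟨k, fun a ↦ hk (Submodule.Quotient.mk a)⟩

/-- Over a Noetherian ring, the torsion of an injective module is injective. -/
theorem injective_torsion {R : Type u} [CommRing R] [IsNoetherianRing R]
    (Z : Set (PrimeSpectrum R)) (J : Type u) [AddCommGroup J] [Module R J] [Module.Injective R J] :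
    Module.Injective R (torsion Z J) := by
  refine Module.Baer.injective fun I f ↦ ?_
  let f' : I →ₗ[R] J := (torsion Z J).subtype ∘ₗ f
  let c : Ideal R := Module.annihilator R (LinearMap.range f')
  have hc : ∀ p ∉ Z, ∃ r ∈ c, r ∉ p.asIdeal := by
    intro p hp
    obtain ⟨r, hr, h0⟩ := exists_smul_eq_zero_of_fg (Z := Z) (N := LinearMap.range f')
      (Module.Finite.iff_fg.mp inferInstance)
      (by rintro _ ⟨a, rfl⟩; exact (f a).2) hp
    exact ⟨r, Module.mem_annihilator.mpr fun m ↦ Subtype.ext (h0 m m.2), hr⟩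
  -- Artin–Rees gives `c ^ (k + 1) ∩ I ⊆ c I`, which `f` kills. So `f` extends over `R ⧸ c ^ (k +
  -- 1)`, a torsion module, whose image in `J` is therefore torsion.
  obtain ⟨k, hk⟩ := Ideal.exists_pow_inf_eq_pow_smul c (M := R) I
  have hk1 := hk (k + 1) (Nat.le_succ k)
  obtain ⟨g, hg⟩ := exists_comp_eq_of_ker_le ((c ^ (k + 1)).mkQ ∘ₗ I.subtype) f' (by
    intro a ha
    have ha' : (a : R) ∈ c ^ (k + 1) := by
      exact (Submodule.Quotient.mk_eq_zero _).mp ha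
    have h2 : (a : R) ∈ c • I := by
      have : (a : R) ∈ c ^ (k + 1 - k) • (c ^ k • ⊤ ⊓ I : Submodule R R) :=
        hk1 ▸ ⟨by simpa using ha', a.2⟩
      rw [Nat.add_sub_cancel_left, pow_one] at this
      exact Submodule.smul_mono le_rfl inf_le_right this
    have h3 : c • I ≤ (LinearMap.ker f').map I.subtype := by
      refine Submodule.smul_le.mpr fun r hr n hn ↦ ⟨r • ⟨n, hn⟩, ?_, rfl⟩
      rw [SetLike.mem_coe, LinearMap.mem_ker, map_smul]
      exact congrArg Subtype.val
        (Module.mem_annihilator.mp hr ⟨f' ⟨n, hn⟩, LinearMap.mem_range_self _ _⟩)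
    obtain ⟨b, hb, hba⟩ := h3 h2
    rwa [← Subtype.ext (a1 := b) (a2 := a) hba])
  have hg1 : ∀ x, g x ∈ torsion Z J := by
    intro x
    refine map_mem_torsion Z g x (mem_torsion_iff.mpr fun p hp ↦ ?_)
    obtain ⟨r, hr, hrp⟩ := hc p hp
    refine ⟨r ^ (k + 1), fun h ↦ hrp (p.isPrime.mem_of_pow_mem _ h), ?_⟩
    obtain ⟨x, rfl⟩ := Submodule.Quotient.mk_surjective _ x
    rw [← Submodule.Quotient.mk_smul, Submodule.Quotient.mk_eq_zero, smul_eq_mul]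
    exact Ideal.mul_mem_right _ _ (Ideal.pow_mem_pow hr _)
  exact ⟨(g ∘ₗ (c ^ (k + 1)).mkQ).codRestrict _ fun x ↦ hg1 _,
    fun x hx ↦ Subtype.ext (hg ⟨x, hx⟩)⟩

/-! ### Consequences of vanishing local cohomology. -/

theorem exact_torsionFunctor_map {R : Type u} [CommRing R] {Z : Set (PrimeSpectrum R)}
    {N : Type u} [AddCommGroup N] [Module R N] (I : InjectiveResolution (ModuleCat.of R N))
    {i : ℕ} (h : Subsingleton (localCohomology Z i N)) :
    (((torsionFunctor Z).mapHomologicalComplex _).obj I.cocomplex).ExactAt i := by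
  rw [HomologicalComplex.exactAt_iff_isZero_homology]
  have : Subsingleton (((torsionFunctor Z).rightDerived i).obj (ModuleCat.of R N)) := h
  exact (ModuleCat.isZero_of_subsingleton _).of_iso (I.isoRightDerivedObj (torsionFunctor Z) i).symm

theorem torsion_eq_bot_of_subsingleton {R : Type u} [CommRing R] {Z : Set (PrimeSpectrum R)}
    {N : Type u} [AddCommGroup N] [Module R N] (h : Subsingleton (localCohomology Z 0 N)) :
    torsion Z N = ⊥ := by
  let I := injectiveResolution (ModuleCat.of R N)
  have he := exact_torsionFunctor_map I h
  rw [HomologicalComplex.exactAt_iff' _ 0 0 1 (by simp) (by simp),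
    ShortComplex.moduleCat_exact_iff] at he
  rw [eq_bot_iff]
  intro x hx
  have hinj : Function.Injective (I.ι.f 0).hom := (ModuleCat.mono_iff_injective _).mp inferInstance
  have hd : ∀ x : N, (I.cocomplex.d 0 1).hom ((I.ι.f 0).hom x) = 0 := fun x ↦
    congr($(I.ι_f_zero_comp_complex_d).hom x)
  obtain ⟨y, hy⟩ := he ⟨(I.ι.f 0).hom x, map_mem_torsion Z (I.ι.f 0).hom x hx⟩
    (Subtype.ext (hd x))
  have hy0 : (I.ι.f 0).hom x = 0 := by
    have h0 : (I.cocomplex.d 0 0).hom y.1 = (I.ι.f 0).hom x := congrArg Subtype.val hy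
    -- Degree 0 has no predecessor; by convention it is its own, and `d 0 0` is zero.
    rw [← h0, I.cocomplex.shape 0 0 (by simp)]
    rfl
  exact hinj (hy0.trans (map_zero _).symm)

/-- If `H¹_Z(N) = 0`, then `N` embeds into an injective module `J` in such a way that every torsion
element of `J / N` lifts to a torsion element of `J`. -/
theorem exists_injective_embedding_of_subsingleton {R : Type u} [CommRing R]
    {Z : Set (PrimeSpectrum R)} {N : Type u} [AddCommGroup N] [Module R N]
    (h : Subsingleton (localCohomology Z 1 N)) :
    ∃ (J : ModuleCat.{u} R) (i : N →ₗ[R] J), Module.Injective R J ∧ Function.Injective i ∧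
      ∀ y : J, (∀ p ∉ Z, ∃ r ∉ p.asIdeal, r • y ∈ LinearMap.range i) →
        ∃ n, y - i n ∈ torsion Z J := by
  let I := injectiveResolution (ModuleCat.of R N)
  have he := exact_torsionFunctor_map I h
  rw [HomologicalComplex.exactAt_iff' _ 0 1 2 (by simp) (by simp),
    ShortComplex.moduleCat_exact_iff] at he
  have hd : ∀ x : N, (I.cocomplex.d 0 1).hom ((I.ι.f 0).hom x) = 0 := fun x ↦
    congr($(I.ι_f_zero_comp_complex_d).hom x)
  refine ⟨I.cocomplex.X 0, (I.ι.f 0).hom, ?_, (ModuleCat.mono_iff_injective _).mp inferInstance,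
    fun y hy ↦ ?_⟩
  · exact (Module.injective_iff_injective_object R (I.cocomplex.X 0)).mpr (I.injective 0)
  · have hdy : (I.cocomplex.d 0 1).hom y ∈ torsion Z (I.cocomplex.X 1) := by
      rw [mem_torsion_iff]
      intro p hp
      obtain ⟨r, hr, n, hn⟩ := hy p hp
      refine ⟨r, hr, ?_⟩
      rw [← map_smul, ← hn]
      exact hd n
    obtain ⟨z, hz⟩ := he ⟨_, hdy⟩ (Subtype.ext congr($(I.cocomplex.d_comp_d 0 1 2).hom y))
    have hz' : (I.cocomplex.d 0 1).hom z.1 = (I.cocomplex.d 0 1).hom y := congrArg Subtype.val hz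
    obtain ⟨n, hn⟩ := (ShortComplex.moduleCat_exact_iff _).mp I.exact₀ (y - z.1)
      (show (I.cocomplex.d 0 1).hom (y - z.1) = 0 by rw [map_sub, hz', sub_self])
    refine ⟨n, ?_⟩
    have hn' : (I.ι.f 0).hom n = y - z.1 := hn
    have : y - (I.ι.f 0).hom n = z.1 := by rw [hn', sub_sub_cancel]
    exact Set.mem_of_eq_of_mem (s := torsion Z (I.cocomplex.X 0)) this z.2

/-- A linear map with torsion kernel and torsion cokernel out of a module with vanishing `H¹_Z` is
surjective modulo torsion. -/
theorem exists_sub_mem_torsion {R : Type u} [CommRing R] [IsNoetherianRing R]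
    {Z : Set (PrimeSpectrum R)} {N E : Type u} [AddCommGroup N] [Module R N] [AddCommGroup E]
    [Module R E] (h : Subsingleton (localCohomology Z 1 N)) (φ : N →ₗ[R] E)
    (hker : LinearMap.ker φ ≤ torsion Z N)
    (hcoker : ∀ e, ∀ p ∉ Z, ∃ r ∉ p.asIdeal, r • e ∈ LinearMap.range φ) (e : E) :
    ∃ n, e - φ n ∈ torsion Z E := by
  obtain ⟨J, i, hJ, hi, hlift⟩ := exists_injective_embedding_of_subsingleton h
  have := injective_torsion Z J
  obtain ⟨ρ, hρ⟩ := Module.Injective.out (R := R) (torsion Z J).subtype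
    (torsion Z J).injective_subtype LinearMap.id
  -- `π` is an idempotent with kernel `Γ_Z(J)`, available because `Γ_Z(J)` is injective and hence a
  -- direct summand.
  let π : J →ₗ[R] J := LinearMap.id - (torsion Z J).subtype ∘ₗ ρ
  have hπ : ∀ y ∈ torsion Z J, π y = 0 := fun y hy ↦ by
    have := hρ ⟨y, hy⟩
    simp only [Submodule.subtype_apply] at this
    simp [π, this]
  have hπ' : ∀ y, y - π y ∈ torsion Z J := fun y ↦ by simp [π]
  obtain ⟨ψ₀, hψ₀⟩ := exists_comp_eq_of_ker_le φ (π ∘ₗ i) fun x hx ↦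
    hπ _ (map_mem_torsion Z i x (hker hx))
  -- Composing with `π` again puts `ψ` in the torsion-free summand, so relations modulo torsion
  -- become equalities.
  let ψ := π ∘ₗ ψ₀
  have hππ : ∀ y, π (π y) = π y := fun y ↦ by
    have := hπ _ (hπ' y)
    rw [map_sub, sub_eq_zero] at this
    exact this.symm
  have hψ : ∀ n, ψ (φ n) = π (i n) := fun n ↦ by simp [ψ, hψ₀, hππ]
  obtain ⟨n, hn⟩ := hlift (ψ e) fun p hp ↦ by
    obtain ⟨r, hr, n, hn⟩ := hcoker e p hp
    obtain ⟨s, hs, h0⟩ := mem_torsion_iff.mp (hπ' (i n)) p hp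
    refine ⟨s * r, p.isPrime.mul_notMem hs hr, s • n, ?_⟩
    rw [mul_smul, ← map_smul ψ, ← hn, hψ, map_smul]
    rwa [smul_sub, sub_eq_zero] at h0
  have hen : ψ (e - φ n) = 0 := by
    have := hπ _ hn
    rw [map_sub, sub_eq_zero] at this
    rw [map_sub, hψ, sub_eq_zero, ← this]
    simp [ψ, hππ]
  -- A multiple of `e - φ n` equals some `φ m`; as `ψ` kills it, `i m` is torsion, hence so are `m`
  -- and `φ m`.
  refine ⟨n, mem_torsion_of_forall_smul_mem fun p hp ↦ ?_⟩
  obtain ⟨r, hr, m, hm⟩ := hcoker (e - φ n) p hp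
  refine ⟨r, hr, hm ▸ map_mem_torsion Z φ m (mem_torsion_of_map_mem hi ?_)⟩
  have h0 : π (i m) = 0 := by rw [← hψ, hm, map_smul, hen, smul_zero]
  simpa [h0] using hπ' (i m)

/-! ### The map `M ⊗ M* → End M`. -/

section TensorDual

variable {R : Type u} [CommRing R] {M : Type v} [AddCommGroup M] [Module R M]

variable (R M) in
/-- The natural map `M ⊗ M* → End(M)`. -/
def tensorDualHom : M ⊗[R] Module.Dual R M →ₗ[R] Module.End R M :=
  dualTensorHom R M M ∘ₗ (TensorProduct.comm R M (Module.Dual R M)).toLinearMap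

@[simp]
theorem tensorDualHom_tmul (m : M) (f : Module.Dual R M) (x : M) :
    tensorDualHom R M (m ⊗ₜ f) x = f x • m := rfl

theorem tensorDualHom_rTensor (e : Module.End R M) (x : M ⊗[R] Module.Dual R M) :
    tensorDualHom R M (e.rTensor _ x) = e ∘ₗ tensorDualHom R M x := by
  induction x with
  | zero => simp
  | add x y hx hy => rw [map_add, map_add, map_add, hx, hy, LinearMap.comp_add]
  | tmul m f => ext; simp

/-- On pure tensors, the scalar `g m` moves across the tensor sign. With `φ y = r • id` and `φ x =
0` this gives `r • x = 0`, so the kernel is torsion. -/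
theorem rTensor_tensorDualHom (x y : M ⊗[R] Module.Dual R M) :
    (tensorDualHom R M y).rTensor _ x = (Module.Dual.transpose (tensorDualHom R M x)).lTensor _ y := by
  induction x with
  | zero => simp
  | add x x' hx hx' => rw [map_add, map_add, hx, hx', map_add, LinearMap.lTensor_add,
      LinearMap.add_apply]
  | tmul m f =>
    induction y with
    | zero => simp
    | add y y' hy hy' => rw [map_add, LinearMap.rTensor_add, LinearMap.add_apply, hy, hy', map_add]
    | tmul n g =>
      have : Module.Dual.transpose (tensorDualHom R M (m ⊗ₜ[R] f)) g = g m • f := by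
        ext x
        simp [Module.Dual.transpose_apply, mul_comm]
      rw [LinearMap.rTensor_tmul, LinearMap.lTensor_tmul, this, tensorDualHom_tmul,
        TensorProduct.smul_tmul]

theorem comp_mem_range_tensorDualHom {n : ℕ} (f : M →ₗ[R] (Fin n → R))
    (g : (Fin n → R) →ₗ[R] M) : g ∘ₗ f ∈ LinearMap.range (tensorDualHom R M) := by
  refine ⟨∑ i, g (Pi.single i 1) ⊗ₜ (LinearMap.proj i ∘ₗ f), ?_⟩
  ext x
  rw [map_sum, LinearMap.sum_apply, LinearMap.comp_apply, LinearMap.pi_apply_eq_sum_univ g (f x)]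
  refine Finset.sum_congr rfl fun i _ ↦ ?_
  rw [tensorDualHom_tmul]
  congr 2
  ext j
  simp [Pi.single_apply, eq_comm]

/-- An endomorphism in the image of `M ⊗ M*` factors through a free module. -/
theorem exists_comp_eq_tensorDualHom (x : M ⊗[R] Module.Dual R M) :
    ∃ (P : Type u) (_ : AddCommGroup P) (_ : Module R P) (_ : Module.Free R P)
      (f : M →ₗ[R] P) (g : P →ₗ[R] M), g ∘ₗ f = tensorDualHom R M x := by
  induction x with
  | zero => exact ⟨PUnit, _, _, inferInstance, 0, 0, by simp⟩
  | add x y hx hy =>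
    obtain ⟨P, _, _, _, f, g, h⟩ := hx
    obtain ⟨P', _, _, _, f', g', h'⟩ := hy
    exact ⟨P × P', _, _, inferInstance, f.prod f', g.coprod g', by
      rw [LinearMap.coprod_comp_prod, h, h', map_add]⟩
  | tmul m f => exact ⟨R, _, _, inferInstance, f, LinearMap.toSpanSingleton R M m, by ext; simp⟩

/-- At a prime where `M` is free, some multiple of the identity outside the prime has finite
rank. -/
theorem exists_smul_one_mem_range_tensorDualHom [IsNoetherianRing R] [Module.Finite R M]
    {p : PrimeSpectrum R} (hp : p ∈ Module.freeLocus R M) :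
    ∃ r ∉ p.asIdeal, r • (1 : Module.End R M) ∈ LinearMap.range (tensorDualHom R M) := by
  have : Module.FinitePresentation R M := Module.finitePresentation_of_finite R M
  obtain ⟨n, g, hg⟩ := Module.Finite.exists_fin' R M
  let S := p.asIdeal.primeCompl
  have hfree : Module.Free (Localization.AtPrime p.asIdeal) (LocalizedModule S M) := hp
  -- Split `R_p ^ n → M_p`, then clear denominators: `t` turns the section into a map `f` over `R`,
  -- and `t'` makes `g ∘ f = t` hold before localizing.
  obtain ⟨s, hs⟩ := Module.projective_lifting_property (LocalizedModule.map S g)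
    (LinearMap.id (M := LocalizedModule S M) (R := Localization S))
    (LocalizedModule.map_surjective S g hg)
  obtain ⟨f, t, hf⟩ := Module.FinitePresentation.exists_lift_of_isLocalizedModule S
    (LocalizedModule.mkLinearMap S (Fin n → R))
    (s.restrictScalars R ∘ₗ LocalizedModule.mkLinearMap S M)
  obtain ⟨t', ht'⟩ := Module.Finite.exists_smul_of_comp_eq_of_isLocalizedModule S
    (LocalizedModule.mkLinearMap S M) (g ∘ₗ f) (t • LinearMap.id) (by
      ext x
      have h1 := congr(LocalizedModule.map S g ($hf x))
      have h2 := congr($hs (LocalizedModule.mkLinearMap S M x))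
      simp only [LinearMap.comp_apply, LinearMap.smul_apply, LinearMap.id_apply,
        LinearMap.coe_restrictScalars, LinearMap.map_smul_of_tower] at h1 h2 ⊢
      rw [h2] at h1
      simpa only [LocalizedModule.mkLinearMap_apply, LocalizedModule.map_mk] using h1)
  refine ⟨t' * t, p.isPrime.mul_notMem t'.2 t.2, ?_⟩
  have : ((t' * t : R) • (1 : Module.End R M)) = (t' : R) • (g ∘ₗ f) := by
    rw [mul_smul]; exact ht'.symm
  rw [this]
  exact Submodule.smul_mem _ _ (comp_mem_range_tensorDualHom f g)

theorem smul_mem_range_tensorDualHom {r : R}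
    (hr : r • (1 : Module.End R M) ∈ LinearMap.range (tensorDualHom R M)) (e : Module.End R M) :
    r • e ∈ LinearMap.range (tensorDualHom R M) := by
  obtain ⟨y, hy⟩ := hr
  exact ⟨e.rTensor _ y, by rw [tensorDualHom_rTensor, hy]; ext; simp⟩

theorem smul_eq_zero_of_mem_ker_tensorDualHom {r : R}
    (hr : r • (1 : Module.End R M) ∈ LinearMap.range (tensorDualHom R M))
    {x : M ⊗[R] Module.Dual R M} (hx : tensorDualHom R M x = 0) : r • x = 0 := by
  obtain ⟨y, hy⟩ := hr
  have := rTensor_tensorDualHom x y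
  rw [hx, hy, map_zero, LinearMap.lTensor_zero, LinearMap.rTensor_smul] at this
  simpa [Module.End.one_eq_id] using this

end TensorDual

/-- A module whose identity has finite rank modulo torsion is the sum of a projective module and its
torsion. -/
theorem exists_isCompl_torsion {R : Type u} [CommRing R] {Z : Set (PrimeSpectrum R)}
    (hR : torsion Z R = ⊥) {M : Type u} [AddCommGroup M] [Module R M]
    {x : M ⊗[R] Module.Dual R M} (hx : ∀ m, m - tensorDualHom R M x m ∈ torsion Z M) :
    ∃ F : Submodule R M, IsCompl F (torsion Z M) ∧ Module.Projective R F := by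
  let e := tensorDualHom R M x
  obtain ⟨P, _, _, _, f, g, hgf⟩ := exists_comp_eq_tensorDualHom x
  have he : ∀ m ∈ torsion Z M, e m = 0 := by
    intro m hm
    change tensorDualHom R M x m = 0
    clear hgf hx
    induction x with
    | zero => simp
    | add x y hx hy => rw [map_add, LinearMap.add_apply, hx, hy, add_zero]
    | tmul n f => rw [tensorDualHom_tmul, dual_apply_eq_zero hR f hm, zero_smul]
  have hee : ∀ m, e (e m) = e m := fun m ↦ by
    have := he _ (hx m)
    rw [map_sub, sub_eq_zero] at this
    exact this.symm
  have hfix : ∀ m ∈ LinearMap.range e, e m = m := by rintro _ ⟨m, rfl⟩; exact hee m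
  refine ⟨LinearMap.range e, ⟨?_, ?_⟩, ?_⟩
  · rw [Submodule.disjoint_def]
    intro m hm ht
    rw [← hfix m hm, he m ht]
  · rw [codisjoint_iff, eq_top_iff]
    intro m _
    exact Submodule.mem_sup.mpr ⟨e m, LinearMap.mem_range_self e m, _, hx m, by simp [e]⟩
  · refine Module.Projective.of_split (f ∘ₗ (LinearMap.range e).subtype)
      (e.rangeRestrict ∘ₗ g) ?_
    ext m
    have := hfix m m.2
    have hgf' : g (f m) = e m := congr($hgf m)
    simp [hgf', this]

end SpecLC

theorem mainTheorem12 {R : Type u} [CommRing R] [IsNoetherianRing R]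
    (Z : Set (PrimeSpectrum R)) (hZ : StableUnderSpecialization Z)
    (hgrade : 1 ≤ SpecLC.grade Z R)
    (M : Type u) [AddCommGroup M] [Module R M] [Module.Finite R M]
    (hNF : SpecLC.nonFreeLocus R M ⊆ Z)
    (hH : Subsingleton (SpecLC.localCohomology Z 1 (M ⊗[R] Module.Dual R M))) :
    (∃ F T : Submodule R M, IsCompl F T ∧ SpecLC.IsTorsion Z T ∧
      Module.Projective R F ∧ (IsLocalRing R → Module.Free R F)) ∧
    (SpecLC.IsTorsionFree Z M →
      Module.Projective R M ∧ (IsLocalRing R → Module.Free R M)) := by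
  have hR : SpecLC.torsion Z R = ⊥ := by
    refine SpecLC.torsion_eq_bot_of_subsingleton (not_nontrivial_iff_subsingleton.mp fun h ↦ ?_)
    have : SpecLC.grade Z R ≤ (0 : ℕ) := iInf₂_le 0 h
    exact absurd (hgrade.trans this) (by simp)
  have hfree : ∀ p ∉ Z, ∃ r ∉ p.asIdeal,
      r • (1 : Module.End R M) ∈ LinearMap.range (SpecLC.tensorDualHom R M) := fun p hp ↦
    SpecLC.exists_smul_one_mem_range_tensorDualHom (not_not.mp fun h ↦ hp (hNF h))
  obtain ⟨x, hx⟩ := SpecLC.exists_sub_mem_torsion hH (SpecLC.tensorDualHom R M)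
    (fun y hy ↦ SpecLC.mem_torsion_iff.mpr fun p hp ↦ by
      obtain ⟨r, hr, h⟩ := hfree p hp
      exact ⟨r, hr, SpecLC.smul_eq_zero_of_mem_ker_tensorDualHom h hy⟩)
    (fun e p hp ↦ by
      obtain ⟨r, hr, h⟩ := hfree p hp
      exact ⟨r, hr, SpecLC.smul_mem_range_tensorDualHom h e⟩) 1
  -- Evaluation at `m` is linear, so it preserves torsion.
  have hx' (m : M) : m - SpecLC.tensorDualHom R M x m ∈ SpecLC.torsion Z M := by
    simpa using SpecLC.map_mem_torsion Z (LinearMap.applyₗ m) _ hx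
  obtain ⟨F, hF, hproj⟩ := SpecLC.exists_isCompl_torsion hR hx'
  refine ⟨⟨F, _, hF, SpecLC.isTorsion_torsion M, hproj, fun _ ↦
    Module.free_of_flat_of_isLocalRing⟩, fun htf ↦ ?_⟩
  have hM : Module.Projective R M := by
    have hF' := hF.codisjoint
    rw [show SpecLC.torsion Z M = ⊥ from htf, codisjoint_bot] at hF'
    exact Module.Projective.of_equiv (LinearEquiv.ofTop F hF')
  exact ⟨hM, fun _ ↦ Module.free_of_flat_of_isLocalRing⟩
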